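/- Let $K$ be an algebraically closed field of arbitrary characteristic. For a nonzero homogeneous polynomial $F \in K[x_0,x_1,x_2,x_3]$ of degree $d \ge 1$, let $X=\{F=0\}\subset\mathbb{P}^3_K$ be the surface of degree $d$ it defines, and let $\mathrm{Sing}(X)$ be the set of points of $\mathbb{P}^3_K$ at which $F$ and all its partial derivatives $\partial F/\partial x_i$ vanish. The multiplicity of $X$ at a point $P$ is the lowest degree of a monomial occurring in the equation of $X$ in affine coordinates centred at $P$. (1) Let $X=\{F=0\}$ be a quartic surface ($d=4$) such that $\mathrm{Sing}(X)$ is a finite set. If $X$ has a triple point (a point of multiplicity $3$), then $|\mathrm{Sing}(X)|\le 7$. (2) More generally, let $X=\{F=0\}$ be a surface of degree $d\ge 1$ such that $\mathrm{Sing}(X)$ is a finite set and $X$ has a point of multiplicity $d-1$. Then $$|\mathrm{Sing}(X)|\le 1+\frac{d(d-1)}{2}.$$ -/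

import Mathlib

open scoped LinearAlgebra.Projectivization

noncomputable section

namespace ProjSurface

variable {K : Type*} [Field K]

/-- The singular locus of the surface `{F = 0}` in `ℙ³`: the points at which the homogeneous form
`F` and all its partial derivatives vanish. (By Euler's formula `F = 0` follows from the other
equations only when the characteristic does not divide the degree, so it is imposed separately.) -/
def singularLocus (F : MvPolynomial (Fin 4) K) : Set (ℙ K (Fin 4 → K)) :=
  {p | MvPolynomial.eval p.rep F = 0 ∧
    ∀ i, MvPolynomial.eval p.rep (MvPolynomial.pderiv i F) = 0}

/-- The equation of the surface `{F = 0}` in the affine chart `x i ≠ 0` of `ℙ³`, in affine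
coordinates centred at the point `[v]` of that chart: substitute `x i = 1` and
`x j = y j + v j / v i` for `j ≠ i`. -/
def localEquation (F : MvPolynomial (Fin 4) K) (v : Fin 4 → K) (i : Fin 4) :
    MvPolynomial {j : Fin 4 // j ≠ i} K :=
  MvPolynomial.aeval
    (fun j => if h : j = i then 1
      else MvPolynomial.X ⟨j, h⟩ + MvPolynomial.C (v j / v i)) F

/-- The surface `{F = 0}` has multiplicity `m` at the point `p` of `ℙ³`: in an affine chart
containing `p`, with coordinates centred at `p`, the lowest degree of a monomial of the equation is
`m`. (For homogeneous `F` this degree does not depend on the chart.) -/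
def HasMultiplicity (F : MvPolynomial (Fin 4) K) (p : ℙ K (Fin 4 → K)) (m : ℕ) : Prop :=
  ∃ i : Fin 4, p.rep i ≠ 0 ∧
    (localEquation F p.rep i : MvPowerSeries {j : Fin 4 // j ≠ i} K).order = m

/-- Multiplicity does not depend on the choice of homogeneous coordinates of the point. -/
theorem hasMultiplicity_mk (F : MvPolynomial (Fin 4) K) (v : Fin 4 → K) (hv : v ≠ 0) (m : ℕ) :
    HasMultiplicity F (Projectivization.mk K v hv) m ↔
      ∃ i : Fin 4, v i ≠ 0 ∧
        (localEquation F v i : MvPowerSeries {j : Fin 4 // j ≠ i} K).order = m := by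
  obtain ⟨a, ha⟩ := Projectivization.exists_smul_eq_mk_rep K v hv
  have ha0 : (a : K) ≠ 0 := a.ne_zero
  have hrep : ∀ j, (Projectivization.mk K v hv).rep j = a * v j := by
    intro j; rw [← ha]; rfl
  have hloc : ∀ i, localEquation F (Projectivization.mk K v hv).rep i = localEquation F v i := by
    intro i
    simp only [localEquation, hrep, mul_div_mul_left _ _ ha0]
  unfold HasMultiplicity
  simp only [hloc, hrep, mul_ne_zero_iff, ha0, ne_eq, not_false_eq_true, true_and]

/-- The singular locus of a homogeneous form, in arbitrary homogeneous coordinates. -/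
theorem mk_mem_singularLocus {F : MvPolynomial (Fin 4) K} {d : ℕ} (hF : F.IsHomogeneous d)
    (v : Fin 4 → K) (hv : v ≠ 0) :
    Projectivization.mk K v hv ∈ singularLocus F ↔
      MvPolynomial.eval v F = 0 ∧ ∀ i, MvPolynomial.eval v (MvPolynomial.pderiv i F) = 0 := by
  obtain ⟨a, ha⟩ := Projectivization.exists_smul_eq_mk_rep K v hv
  have ha0 : (a : K) ≠ 0 := a.ne_zero
  have key : ∀ {G : MvPolynomial (Fin 4) K} {e : ℕ}, G.IsHomogeneous e →
      (MvPolynomial.eval (Projectivization.mk K v hv).rep G = 0 ↔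
        MvPolynomial.eval v G = 0) := by
    intro G e hG
    have : MvPolynomial.eval (Projectivization.mk K v hv).rep G =
        (a : K) ^ e * MvPolynomial.eval v G := by
      rw [← ha, MvPolynomial.eval_eq', MvPolynomial.eval_eq', Finset.mul_sum]
      refine Finset.sum_congr rfl fun s hs => ?_
      have hs' : ∑ i, s i = e := by
        rw [← hG (MvPolynomial.mem_support_iff.mp hs), Finsupp.weight_apply,
          Finsupp.sum_fintype _ _ (by simp)]
        simp
      have hprod : ∏ i, ((a • v) i) ^ s i = (a : K) ^ e * ∏ i, v i ^ s i := by
        rw [← hs', ← Finset.prod_pow_eq_pow_sum, ← Finset.prod_mul_distrib]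
        exact Finset.prod_congr rfl fun i _ => mul_pow _ _ _
      rw [hprod]
      ring
    rw [this]
    simp [ha0]
  simp only [singularLocus, Set.mem_ofPred_eq, key hF, fun i => key (hF.pderiv (i := i))]

end ProjSurface

end

noncomputable section

namespace ProjSurface

open MvPolynomial

/-! ### Homogeneous polynomials -/

/-! Let `X` have degree `d + 1` and a point `p` of multiplicity `d`. Then `F = x_i g + f`, with `f`,
`g` forms of degrees `d + 1`, `d` in the three coordinates of the projection from `p`. A point `x`
over `u` is singular iff `f(u) = g(u) = 0` and `x_i ∇g(u) + ∇f(u) = 0`. Two singular points over the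
same `u` would give `∇f(u) = ∇g(u) = 0`, hence a whole line of singular points; so the projection is
injective on `Sing(X) \ {p}`. A common factor `h` of `f` and `g` would give `F = B h` and a singular
curve `B = h = 0`; so `f` and `g` are coprime. At each image point the gradients are dependent, so
the plane curves `f` and `g` share a tangent direction and meet with multiplicity at least 2. Bézout
then gives `2N ≤ d(d + 1)`.

This form of Bézout is `two_mul_card_le_of_isRelPrime`, a dimension count in one large degree;
`infinite_setOf_eval_rep_eq_zero` supplies the singular curve through Krull's height theorem. -/

/-- Lowest and highest degrees both add under multiplication. They agree for the product, hence for
each factor. The lowest degree is read off as the order of a power series. -/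
theorem isHomogeneous_of_mul {σ K : Type*} [Field K] {A B : MvPolynomial σ K} {n : ℕ}
    (h : (A * B).IsHomogeneous n) (h0 : A * B ≠ 0) : A.IsHomogeneous A.totalDegree := by
  have hA : A ≠ 0 := left_ne_zero_of_mul h0
  have hB : B ≠ 0 := right_ne_zero_of_mul h0
  have key : ∀ C : MvPolynomial σ K, C ≠ 0 → ∃ k : ℕ, (C : MvPowerSeries σ K).order = k ∧
      k ≤ C.totalDegree ∧ ∀ d, coeff d C ≠ 0 → k ≤ d.degree := by
    intro C hC
    have hC' : (C : MvPowerSeries σ K) ≠ 0 := by simpa using hC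
    have h1 := MvPowerSeries.ne_zero_iff_order_finite.mp hC'
    obtain ⟨d, hd, hd'⟩ := MvPowerSeries.exists_coeff_ne_zero_and_order h1
    rw [MvPolynomial.coeff_coe] at hd
    refine ⟨d.degree, hd'.symm, le_totalDegree (mem_support_iff.mpr hd), fun e he => ?_⟩
    rw [← MvPolynomial.coeff_coe] at he
    have := MvPowerSeries.order_le he
    rw [← hd'] at this
    exact_mod_cast this
  obtain ⟨a, ha, ha', haA⟩ := key A hA
  obtain ⟨b, hb, hb', -⟩ := key B hB
  have hT := totalDegree_mul_of_isDomain hA hB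
  rw [h.totalDegree h0] at hT
  have hO := MvPowerSeries.order_mul (A : MvPowerSeries σ K) (B : MvPowerSeries σ K)
  rw [← MvPolynomial.coe_mul, ha, hb] at hO
  have hO' : ((A * B : MvPolynomial σ K) : MvPowerSeries σ K).order = ((a + b : ℕ) : ℕ∞) := by
    rw [hO]; push_cast; rfl
  obtain ⟨⟨d, hd, hd'⟩, -⟩ := MvPowerSeries.order_eq_nat.mp hO'
  rw [MvPolynomial.coeff_coe] at hd
  have hn : d.degree = n := by
    by_contra hne
    exact hd (h.coeff_eq_zero hne)
  have hat : a = A.totalDegree := by omega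
  intro d hd
  have h1 := haA d hd
  have h2 : d.degree ≤ A.totalDegree := le_totalDegree (mem_support_iff.mpr hd)
  have h3 : d.degree = A.totalDegree := by omega
  rw [← h3, Finsupp.degree_eq_weight_one]
  rfl

theorem eval_smul_of_isHomogeneous {σ K : Type*} [Field K] {G : MvPolynomial σ K} {e : ℕ}
    (hG : G.IsHomogeneous e) (a : K) (v : σ → K) : eval (a • v) G = a ^ e * eval v G := by
  rw [eval_eq, eval_eq, Finset.mul_sum]
  refine Finset.sum_congr rfl fun s hs => ?_
  have hs' : ∑ i ∈ s.support, s i = e := by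
    rw [← hG (mem_support_iff.mp hs)]
    change s.degree = _
    rw [Finsupp.degree_eq_weight_one]
    rfl
  simp only [Pi.smul_apply, smul_eq_mul, mul_pow, Finset.prod_mul_distrib,
    Finset.prod_pow_eq_pow_sum, hs']
  ring

/-! ### Common zeros of two forms -/

/-- The ideal generated by the variables in `s`. -/
def coordPrime {σ : Type*} (K : Type*) [Field K] (s : Set σ) : Ideal (MvPolynomial σ K) :=
  open Classical in
  RingHom.ker (aeval (R := K) fun i => if i ∈ s then (0 : MvPolynomial σ K) else X i)

instance {σ K : Type*} [Field K] (s : Set σ) : (coordPrime K s).IsPrime :=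
  RingHom.ker_isPrime _

/-- Adjoining one variable at a time gives a strict chain of primes. -/
theorem card_le_height_coordPrime {σ K : Type*} [Field K] (s : Finset σ) :
    (s.card : ℕ∞) ≤ (coordPrime K (s : Set σ)).height := by
  classical
  induction s using Finset.induction with
  | empty => simp
  | insert a s ha ih =>
    rw [Finset.card_insert_of_notMem ha]
    push_cast
    refine (add_le_add_left ih 1).trans (Ideal.height_add_one_le_of_lt_of_isPrime ?_)
    refine lt_of_le_of_ne ?_ ?_
    · intro p hp
      simp only [coordPrime, RingHom.mem_ker] at hp ⊢
      have := congrArg (aeval (R := K)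
        fun i => if i ∈ insert a (s : Set σ) then (0 : MvPolynomial σ K) else X i) hp
      rw [map_zero, ← AlgHom.comp_apply, comp_aeval] at this
      refine Eq.trans (congrArg (fun φ => aeval (R := K) φ p) (funext fun i => ?_)) this
      by_cases h1 : i ∈ s <;> simp [h1]
    · intro h
      have : (X a : MvPolynomial σ K) ∈ coordPrime K (insert a (s : Set σ)) := by
        simp [coordPrime]
      rw [← h] at this
      simp [coordPrime, ha] at this

theorem card_le_height_vanishingIdeal_zero {σ K : Type*} [Field K] [Fintype σ] :
    (Fintype.card σ : ℕ∞) ≤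
      (vanishingIdeal K {(0 : σ → K)} : Ideal (MvPolynomial σ K)).height := by
  refine (card_le_height_coordPrime (K := K) (Finset.univ : Finset σ)).trans
    (Ideal.height_mono fun p hp => ?_)
  rw [mem_vanishingIdeal_singleton_iff]
  simp only [coordPrime, RingHom.mem_ker] at hp
  have := congrArg (aeval (R := K) (0 : σ → K)) hp
  rw [map_zero, ← AlgHom.comp_apply, comp_aeval] at this
  refine Eq.trans (congrArg (fun φ => aeval (R := K) φ p) (funext fun i => ?_)) this
  simp

/-- The linear form on `σ → K` as a polynomial. -/
def linForm {σ K : Type*} [Field K] [Fintype σ] [DecidableEq σ] (f : Module.Dual K (σ → K)) :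
    MvPolynomial σ K :=
  ∑ i, C (f (Pi.single i 1)) * X i

theorem sum_apply_single_mul {σ K : Type*} [Field K] [Fintype σ] [DecidableEq σ]
    (f : Module.Dual K (σ → K)) (x : σ → K) : ∑ i, f (Pi.single i 1) * x i = f x := by
  conv_rhs => rw [pi_eq_sum_univ' x]
  simp only [map_sum, map_smul, smul_eq_mul]
  exact Finset.sum_congr rfl fun i _ => mul_comm _ _

theorem eval_linForm {σ K : Type*} [Field K] [Fintype σ] [DecidableEq σ]
    (f : Module.Dual K (σ → K)) (x : σ → K) : eval x (linForm f) = f x := by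
  simp [linForm, sum_apply_single_mul]

theorem isHomogeneous_linForm {σ K : Type*} [Field K] [Fintype σ] [DecidableEq σ]
    (f : Module.Dual K (σ → K)) : (linForm f).IsHomogeneous 1 :=
  IsHomogeneous.sum _ _ _ fun i _ => isHomogeneous_C_mul_X _ i

/-- Two forms of positive degree in at least four variables have infinitely many common zeros in
projective space. -/
theorem infinite_setOf_eval_rep_eq_zero {σ K : Type*} [Field K] [IsAlgClosed K] [Fintype σ]
    (hσ : 4 ≤ Fintype.card σ) {A B : MvPolynomial σ K} {a b : ℕ} (hA : A.IsHomogeneous a)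
    (hB : B.IsHomogeneous b) (ha : a ≠ 0) (hb : b ≠ 0) :
    {p : ℙ K (σ → K) | eval p.rep A = 0 ∧ eval p.rep B = 0}.Infinite := by
  classical
  intro hfin
  have : Finite {p : ℙ K (σ → K) | eval p.rep A = 0 ∧ eval p.rep B = 0} := hfin
  have : Infinite K := IsAlgClosed.instInfinite
  -- If there were only finitely many common zeros, some hyperplane would miss them all, leaving the
  -- origin as the only affine zero of `A`, `B`, `l`.
  obtain ⟨f, hf⟩ := Module.exists_dual_forall_apply_ne_zero (K := K)
    (fun p : {p : ℙ K (σ → K) | eval p.rep A = 0 ∧ eval p.rep B = 0} => p.1.rep)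
    (fun p => p.1.rep_nonzero)
  let l : MvPolynomial σ K := linForm f
  have hl : ∀ x, eval x l = f x := eval_linForm f
  let J : Ideal (MvPolynomial σ K) := Ideal.span {A, B, l}
  have h0 : ∀ {G : MvPolynomial σ K} {e : ℕ}, G.IsHomogeneous e → e ≠ 0 →
      eval (0 : σ → K) G = 0 := by
    intro G e hG he
    have := eval_smul_of_isHomogeneous hG 0 (0 : σ → K)
    simpa [he] using this
  have hJ : zeroLocus K J = {(0 : σ → K)} := by
    rw [zeroLocus_span]
    ext x
    simp only [Set.mem_insert_iff, Set.mem_singleton_iff, forall_eq_or_imp, forall_eq,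
      Set.mem_ofPred_eq, aeval_eq_eval]
    refine ⟨fun ⟨h1, h2, h3⟩ => ?_, ?_⟩
    · by_contra hx
      obtain ⟨c, hc⟩ := Projectivization.exists_smul_eq_mk_rep K x hx
      have hc' : (c : K) • x = (Projectivization.mk K x hx).rep := hc
      refine hf ⟨Projectivization.mk K x hx, ?_, ?_⟩ ?_
      · rw [← hc', eval_smul_of_isHomogeneous hA]; simp_all
      · rw [← hc', eval_smul_of_isHomogeneous hB]; simp_all
      · rw [← hc', map_smul, ← hl]; simp_all
    · rintro rfl
      exact ⟨h0 hA ha, h0 hB hb, (hl 0).trans (map_zero f)⟩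
  have hrad := vanishingIdeal_zeroLocus_eq_radical (K := K) J
  rw [hJ] at hrad
  -- By the Nullstellensatz the ideal of the origin is the radical of `J`, so its height is at most
  -- 3, the number of generators; but it is at least the number of variables.
  have hmin : vanishingIdeal K {(0 : σ → K)} ∈ J.minimalPrimes := by
    rw [← Ideal.radical_minimalPrimes, ← hrad, Ideal.minimalPrimes_eq_subsingleton_self]
    rfl
  have h1 := Ideal.height_le_card_of_mem_minimalPrimes_span (Set.toFinite _) hmin
  have h2 := (card_le_height_vanishingIdeal_zero (σ := σ) (K := K)).trans h1
  have h3 : ({A, B, l} : Set (MvPolynomial σ K)).ncard ≤ 3 :=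
    (Set.ncard_insert_le _ _).trans (Nat.succ_le_succ ((Set.ncard_insert_le _ _).trans (by simp)))
  have h4 : Fintype.card σ ≤ ({A, B, l} : Set (MvPolynomial σ K)).ncard := by exact_mod_cast h2
  omega

/-! ### Double points of a plane intersection -/

theorem finrank_homogeneousSubmodule {σ K : Type*} [Field K] [Fintype σ]
    (hσ : Fintype.card σ = 3) (n : ℕ) :
    Module.finrank K (homogeneousSubmodule σ K n) = (n + 2).choose 2 := by
  classical
  have hS : homogeneousSubmodule σ K n
      = restrictSupport K ((Finset.univ.finsuppAntidiag n : Finset (σ →₀ ℕ)) : Set (σ →₀ ℕ)) := by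
    rw [homogeneousSubmodule_eq_finsupp_supported]
    unfold restrictSupport
    congr 1
    ext d
    simp [Finsupp.degree_eq_sum]
  rw [hS, Module.finrank_eq_card_basis (basisRestrictSupport K _)]
  simp only [Finset.coe_sort_coe, Fintype.card_coe, Finset.card_finsuppAntidiag_nat_eq_choose,
    Finset.card_univ, hσ]
  rw [show 3 + n - 1 = n + 2 by omega]
  exact Nat.choose_symm_of_eq_add (by omega)

instance {σ K : Type*} [Field K] [Finite σ] (n : ℕ) :
    FiniteDimensional K (homogeneousSubmodule σ K n) :=
  Module.Finite.iff_fg.mpr (homogeneousSubmodule_fg σ K n)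

/-- The derivative at `v` in the direction `w`. -/
def dirDeriv {σ K : Type*} [Field K] [Fintype σ] (v w : σ → K) : MvPolynomial σ K →ₗ[K] K :=
  ∑ j, w j • (aeval (R := K) v).toLinearMap ∘ₗ (pderiv j).toLinearMap

section dirDeriv

variable {σ K : Type*} [Field K] [Fintype σ] (v w : σ → K)

theorem dirDeriv_apply (p : MvPolynomial σ K) :
    dirDeriv v w p = ∑ j, w j * eval v (pderiv j p) := by
  simp [dirDeriv, aeval_eq_eval]

theorem dirDeriv_mul (p q : MvPolynomial σ K) :
    dirDeriv v w (p * q) = eval v p * dirDeriv v w q + eval v q * dirDeriv v w p := by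
  simp only [dirDeriv_apply, Derivation.leibniz, smul_eq_mul, map_add, map_mul, Finset.mul_sum,
    ← Finset.sum_add_distrib]
  exact Finset.sum_congr rfl fun j _ => by ring

theorem dirDeriv_pow_eq_zero {p : MvPolynomial σ K} (h : dirDeriv v w p = 0) (n : ℕ) :
    dirDeriv v w (p ^ n) = 0 := by
  induction n with
  | zero => simp [dirDeriv_apply]
  | succ n ih => rw [pow_succ, dirDeriv_mul, h, ih, mul_zero, mul_zero, add_zero]

theorem dirDeriv_linForm [DecidableEq σ] (f : Module.Dual K (σ → K)) :
    dirDeriv v w (linForm f) = f w := by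
  rw [dirDeriv_apply, ← sum_apply_single_mul f w]
  refine Finset.sum_congr rfl fun j _ => ?_
  simp [linForm, pderiv_X, Pi.single_apply, mul_comm]

end dirDeriv

theorem exists_dual_apply_pair {V K : Type*} [Field K] [AddCommGroup V] [Module K V] {v w : V}
    (h : LinearIndependent K ![v, w]) (a b : K) :
    ∃ f : Module.Dual K V, f v = a ∧ f w = b := by
  obtain ⟨g, hg⟩ := LinearMap.exists_leftInverse_of_injective
    (Fintype.linearCombination K ![v, w])
    (LinearMap.ker_eq_bot.mpr h.fintypeLinearCombination_injective)
  have hg' : ∀ c, g (c 0 • v + c 1 • w) = c := fun c => by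
    have := LinearMap.congr_fun hg c
    simpa [Fintype.linearCombination_apply] using this
  refine ⟨Fintype.linearCombination K ![a, b] ∘ₗ g, ?_, ?_⟩
  · have := hg' ![1, 0]
    simp at this
    simp [this, Fintype.linearCombination_apply]
  · have := hg' ![0, 1]
    simp at this
    simp [this, Fintype.linearCombination_apply]

/-- Values and directional derivatives at finitely many points are interpolated by forms of any
large degree. -/
theorem exists_isHomogeneous_eval_dirDeriv {σ K ι : Type*} [Field K] [Fintype σ] [Fintype ι]
    {v w : ι → σ → K} (hw : ∀ k, LinearIndependent K ![v k, w k])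
    (hv : Pairwise fun k l => LinearIndependent K ![v k, v l])
    (s t : ι → K) (M : ℕ) :
    ∃ p : MvPolynomial σ K, p.IsHomogeneous (2 * (Fintype.card ι - 1) + M + 1) ∧
      ∀ k, eval (v k) p = s k ∧ dirDeriv (v k) (w k) p = t k := by
  classical
  have hl : ∀ k l, ∃ f : Module.Dual K (σ → K), k ≠ l → f (v k) = 1 ∧ f (v l) = 0 := by
    intro k l
    by_cases hkl : k = l
    · exact ⟨0, fun h => absurd hkl h⟩
    · obtain ⟨f, hf⟩ := exists_dual_apply_pair (hv hkl) 1 0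
      exact ⟨f, fun _ => hf⟩
  choose f hf using hl
  choose α hα using fun k => exists_dual_apply_pair (hw k) 1 0
  -- The squares make `q k` vanish to second order at every other point.
  let q : ι → MvPolynomial σ K := fun k => ∏ l ∈ Finset.univ.erase k, linForm (f k l) ^ 2
  have hqh : ∀ k, (q k).IsHomogeneous (2 * (Fintype.card ι - 1)) := by
    intro k
    have := IsHomogeneous.prod (Finset.univ.erase k) (fun l => linForm (f k l) ^ 2)
      (fun _ => 1 * 2) (fun l _ => (isHomogeneous_linForm (f k l)).pow 2)
    convert this using 1
    simp [mul_comm]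
  have hq1 : ∀ k, eval (v k) (q k) = 1 := by
    intro k
    simp only [q, map_prod, map_pow, eval_linForm]
    refine Finset.prod_eq_one fun l hl => ?_
    rw [(hf k l (Finset.ne_of_mem_erase hl).symm).1, one_pow]
  have hq0 : ∀ k l, k ≠ l → eval (v l) (q k) = 0 ∧ dirDeriv (v l) (w l) (q k) = 0 := by
    intro k l hkl
    obtain ⟨r, hr⟩ := Finset.dvd_prod_of_mem (fun l => linForm (f k l) ^ 2)
      (Finset.mem_erase.mpr ⟨hkl.symm, Finset.mem_univ l⟩)
    have h0 : eval (v l) (linForm (f k l)) = 0 := by rw [eval_linForm, (hf k l hkl).2]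
    constructor
    · simp [show q k = _ * r from hr, h0]
    · rw [show q k = _ * r from hr, dirDeriv_mul, sq, dirDeriv_mul]
      simp [h0]
  -- `γ k` prescribes the value `s k`, and its derivative is corrected by the contribution of `q k`.
  -- The powers of `α k` only pad the degree: value 1, derivative 0.
  choose γ hγ using fun k => exists_dual_apply_pair (hw k) (s k)
    (t k - s k * dirDeriv (v k) (w k) (q k))
  let r : ι → MvPolynomial σ K := fun k => q k * (linForm (α k) ^ M * linForm (γ k))
  refine ⟨∑ k, r k, IsHomogeneous.sum _ _ _ fun k _ => ?_, fun k => ?_⟩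
  · have := (hqh k).mul (((isHomogeneous_linForm (α k)).pow M).mul (isHomogeneous_linForm (γ k)))
    convert this using 1
    ring
  · have hd : dirDeriv (v k) (w k) (linForm (α k) ^ M) = 0 :=
      dirDeriv_pow_eq_zero _ _ (by rw [dirDeriv_linForm, (hα k).2]) M
    constructor
    · rw [map_sum, Finset.sum_eq_single k]
      · simp [r, hq1, eval_linForm, hα, hγ]
      · intro l _ hl
        simp [r, (hq0 l k hl).1]
      · simp
    · rw [map_sum, Finset.sum_eq_single k]
      · simp only [r, dirDeriv_mul, hq1, hd, map_mul, map_pow, eval_linForm, dirDeriv_linForm,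
          (hα k).1, (hγ k).1, (hγ k).2]
        ring
      · intro l _ hl
        simp [r, dirDeriv_mul, (hq0 l k hl).1, (hq0 l k hl).2]
      · simp

/-- Hilbert function count: forms of degree `a + b + t` modulo two coprime forms of degrees `a` and
`b` have dimension `a * b`. -/
theorem choose_two_add (a b t : ℕ) :
    (a + b + t + 2).choose 2 + (t + 2).choose 2
      = (b + t + 2).choose 2 + (a + t + 2).choose 2 + a * b := by
  have h : ∀ n : ℕ, 2 * (n + 2).choose 2 = (n + 2) * (n + 1) := by
    intro n
    have := Nat.add_one_mul_choose_eq (n + 1) 1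
    simp at this
    linarith
  have h1 := h (a + b + t)
  have h2 := h t
  have h3 := h (b + t)
  have h4 := h (a + t)
  nlinarith

theorem inf_map_mul_le {σ K : Type*} [Field K] {f g : MvPolynomial σ K} {a b t : ℕ}
    (hg : g.IsHomogeneous b) (hg0 : g ≠ 0) (hrel : IsRelPrime f g) :
    (homogeneousSubmodule σ K (b + t)).map (LinearMap.mulLeft K f) ⊓
        (homogeneousSubmodule σ K (a + t)).map (LinearMap.mulLeft K g)
      ≤ (homogeneousSubmodule σ K t).map (LinearMap.mulLeft K (f * g)) := by
  rintro x ⟨⟨p, hp, rfl⟩, ⟨q, -, hq⟩⟩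
  simp only [LinearMap.mulLeft_apply] at hq ⊢
  obtain ⟨c, rfl⟩ : g ∣ p := hrel.symm.dvd_of_dvd_mul_left ⟨q, hq.symm⟩
  refine ⟨c, ?_, by simp⟩
  by_cases hc : c = 0
  · rw [hc]; exact Submodule.zero_mem _
  have hp' : (c * g).IsHomogeneous (b + t) := by rw [mul_comm]; exact hp
  have hne : c * g ≠ 0 := mul_ne_zero hc hg0
  have hch := isHomogeneous_of_mul hp' hne
  have := (hch.mul hg).inj_right hp' hne
  have ht : c.totalDegree = t := by omega
  rw [ht] at hch
  exact hch

/-- Two coprime plane curves of degrees `a` and `b` have at most `a * b / 2` intersection points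
with a common tangent direction. -/
theorem two_mul_card_le_of_isRelPrime {σ K ι : Type*} [Field K] [Fintype σ] [Fintype ι]
    (hσ : Fintype.card σ = 3) {f g : MvPolynomial σ K} {a b : ℕ}
    (hf : f.IsHomogeneous a) (hg : g.IsHomogeneous b) (hg0 : g ≠ 0) (hrel : IsRelPrime f g)
    {v w : ι → σ → K} (hw : ∀ k, LinearIndependent K ![v k, w k])
    (hv : Pairwise fun k l => LinearIndependent K ![v k, v l])
    (hfv : ∀ k, eval (v k) f = 0) (hgv : ∀ k, eval (v k) g = 0)
    (hfw : ∀ k, dirDeriv (v k) (w k) f = 0) (hgw : ∀ k, dirDeriv (v k) (w k) g = 0) :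
    2 * Fintype.card ι ≤ a * b := by
  classical
  by_cases hf0 : f = 0
  · have hu : IsUnit g := hrel (hf0 ▸ dvd_zero g) dvd_rfl
    have : IsEmpty ι := ⟨fun k => (hu.map (eval (v k))).ne_zero (hgv k)⟩
    simp
  -- Makes `a + b + t` the interpolation degree with padding `a + b`.
  let t : ℕ := 2 * (Fintype.card ι - 1) + 1
  let S : ℕ → Submodule K (MvPolynomial σ K) := homogeneousSubmodule σ K
  let ev : MvPolynomial σ K →ₗ[K] ι → K × K :=
    LinearMap.pi fun k => (aeval (R := K) (v k)).toLinearMap.prod (dirDeriv (v k) (w k))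
  let ev' := ev.domRestrict (S (a + b + t))
  have hsurj : LinearMap.range ev' = ⊤ := by
    rw [LinearMap.range_eq_top]
    intro y
    obtain ⟨p, hp, hpy⟩ := exists_isHomogeneous_eval_dirDeriv hw hv
      (fun k => (y k).1) (fun k => (y k).2) (a + b)
    have hp' : p ∈ S (a + b + t) := by
      change p.IsHomogeneous _
      convert hp using 1
      simp only [t]; ring
    refine ⟨⟨p, hp'⟩, funext fun k => ?_⟩
    simp [ev', ev, aeval_eq_eval, hpy]
  have hdim := ev'.finrank_range_add_finrank_ker
  rw [hsurj, finrank_top, finrank_homogeneousSubmodule hσ] at hdim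
  have hι : Module.finrank K (ι → K × K) = 2 * Fintype.card ι := by
    simp [Module.finrank_pi_fintype, mul_comm]
  let U := (S (b + t)).map (LinearMap.mulLeft K f)
  let V := (S (a + t)).map (LinearMap.mulLeft K g)
  let W := (S t).map (LinearMap.mulLeft K (f * g))
  have hinj : ∀ {h : MvPolynomial σ K}, h ≠ 0 → ∀ n,
      Module.finrank K ((S n).map (LinearMap.mulLeft K h)) = (n + 2).choose 2 := by
    intro h hh n
    rw [← finrank_homogeneousSubmodule (K := K) hσ n]
    exact (Submodule.equivMapOfInjective _ (mul_right_injective₀ hh) _).finrank_eq.symm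
  have hUV := Submodule.finrank_sup_add_finrank_inf_eq U V
  rw [hinj hf0, hinj hg0] at hUV
  have hW : Module.finrank K ↥(U ⊓ V) ≤ (t + 2).choose 2 := by
    rw [← hinj (mul_ne_zero hf0 hg0) t]
    exact Submodule.finrank_mono (inf_map_mul_le hg hg0 hrel)
  -- By Leibniz, multiples of `f` and `g` inherit the vanishing values and derivatives. The `2N`
  -- independent conditions therefore number at most the codimension of `U ⊔ V`, which is at most `a
  -- * b`.
  have hle : U ⊔ V ≤ (LinearMap.ker ev').map (S (a + b + t)).subtype := by
    have aux : ∀ {h q : MvPolynomial σ K}, (h * q).IsHomogeneous (a + b + t) →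
        (∀ k, eval (v k) h = 0) → (∀ k, dirDeriv (v k) (w k) h = 0) →
        h * q ∈ (LinearMap.ker ev').map (S (a + b + t)).subtype := by
      intro h q hh h1 h2
      refine ⟨⟨h * q, hh⟩, ?_, rfl⟩
      rw [SetLike.mem_coe, LinearMap.mem_ker]
      funext k
      simp [ev', ev, aeval_eq_eval, dirDeriv_mul, h1, h2]
    refine sup_le ?_ ?_
    · rintro _ ⟨q, hq, rfl⟩
      refine aux ?_ hfv hfw
      convert hf.mul (show q.IsHomogeneous _ from hq) using 1
      ring
    · rintro _ ⟨q, hq, rfl⟩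
      refine aux ?_ hgv hgw
      convert hg.mul (show q.IsHomogeneous _ from hq) using 1
      ring
  have hle' := Submodule.finrank_mono hle
  rw [Submodule.finrank_map_subtype_eq] at hle'
  have := choose_two_add a b t
  omega

/-! ### Projection from a point -/

section projection

variable {K : Type*} [Field K] (i : Fin 4) (c : Fin 4 → K)

/-- The linear projection with centre `c`, normalized by `c i = 1`, to the hyperplane `x i = 0`. -/
def proj (x : Fin 4 → K) : {j : Fin 4 // j ≠ i} → K := fun j => x j - c j * x i

/-- Pull-back of polynomials along the projection. -/
def coneMap : MvPolynomial {j : Fin 4 // j ≠ i} K →ₐ[K] MvPolynomial (Fin 4) K :=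
  aeval fun j => X (j : Fin 4) - C (c j) * X i

theorem eval_coneMap (x : Fin 4 → K) (p : MvPolynomial {j : Fin 4 // j ≠ i} K) :
    eval x (coneMap i c p) = eval (proj i c x) p := by
  rw [coneMap, ← aeval_eq_eval, ← aeval_eq_eval]
  change aeval x (aeval _ p) = aeval _ p
  rw [← AlgHom.comp_apply, comp_aeval]
  congr 2
  funext j
  simp [proj]

theorem isHomogeneous_coneMap {p : MvPolynomial {j : Fin 4 // j ≠ i} K} {n : ℕ}
    (hp : p.IsHomogeneous n) : (coneMap i c p).IsHomogeneous n := by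
  have := hp.aeval (S := K) (n := 1)
    (fun j : {j : Fin 4 // j ≠ i} => (X (j : Fin 4) - C (c j) * X i : MvPolynomial (Fin 4) K))
    (fun j => (isHomogeneous_X K _).sub (isHomogeneous_C_mul_X _ _))
  rwa [one_mul] at this

/-- The chain rule for a linear substitution. -/
theorem pderiv_coneMap (k : Fin 4) (p : MvPolynomial {j : Fin 4 // j ≠ i} K) :
    pderiv k (coneMap i c p) =
      ∑ j, coneMap i c (pderiv j p) * pderiv k (X (j : Fin 4) - C (c j) * X i) := by
  classical
  induction p using MvPolynomial.induction_on with
  | C a => simp [coneMap, algebraMap_eq]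
  | add p q hp hq => simp only [map_add, hp, hq, add_mul, Finset.sum_add_distrib]
  | mul_X p l hp =>
    have hX : coneMap i c (X l) = X (l : Fin 4) - C (c l) * X i := by simp [coneMap]
    have h1 : ∀ j, coneMap i c (pderiv j (p * X l)) * pderiv k (X (j : Fin 4) - C (c j) * X i)
        = (if j = l then coneMap i c p * pderiv k (X (j : Fin 4) - C (c j) * X i) else 0)
          + coneMap i c (X l) * (coneMap i c (pderiv j p)
            * pderiv k (X (j : Fin 4) - C (c j) * X i)) := by
      intro j
      rw [Derivation.leibniz, pderiv_X]
      by_cases h : j = l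
      · subst h
        simp only [Pi.single_eq_same, smul_eq_mul, map_add, map_mul, map_one, if_true]
        ring
      · rw [Pi.single_eq_of_ne' h, if_neg h]
        simp only [smul_eq_mul, map_add, map_mul, map_zero]
        ring
    rw [Finset.sum_congr rfl fun j _ => h1 j, Finset.sum_add_distrib, ← Finset.mul_sum, ← hp,
      Finset.sum_ite_eq' Finset.univ l, map_mul, Derivation.leibniz, hX]
    simp

variable {i c}

theorem proj_smul (a : K) (x : Fin 4 → K) : proj i c (a • x) = a • proj i c x := by
  funext j
  simp [proj]
  ring

theorem eq_of_proj_eq {x y : Fin 4 → K} (h : proj i c x = proj i c y) (hi : x i = y i) :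
    x = y := by
  funext j
  by_cases hj : j = i
  · rw [hj, hi]
  · have := congrFun h ⟨j, hj⟩
    simp only [proj, hi] at this
    exact sub_left_injective this

/-- Once the other partials vanish, the `i`-th one equals `g` at the projection, and then `F = 0`
gives `f = 0`. Euler's formula is avoided, so the characteristic plays no role. -/
theorem singular_iff_of_eq_add {F : MvPolynomial (Fin 4) K}
    {f g : MvPolynomial {j : Fin 4 // j ≠ i} K}
    (hF : F = X i * coneMap i c g + coneMap i c f) (x : Fin 4 → K) :
    (eval x F = 0 ∧ ∀ k, eval x (pderiv k F) = 0) ↔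
      eval (proj i c x) f = 0 ∧ eval (proj i c x) g = 0 ∧
        ∀ j, x i * eval (proj i c x) (pderiv j g) + eval (proj i c x) (pderiv j f) = 0 := by
  classical
  have h0 : eval x F = x i * eval (proj i c x) g + eval (proj i c x) f := by
    simp [hF, eval_coneMap]
  have hne : ∀ j : {j : Fin 4 // j ≠ i}, eval x (pderiv (j : Fin 4) F) =
      x i * eval (proj i c x) (pderiv j g) + eval (proj i c x) (pderiv j f) := by
    intro j
    have hs : ∀ p : MvPolynomial {j : Fin 4 // j ≠ i} K,
        pderiv (j : Fin 4) (coneMap i c p) = coneMap i c (pderiv j p) := by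
      intro p
      rw [pderiv_coneMap, Finset.sum_eq_single j]
      · simp [pderiv_X, j.2.symm]
      · intro l _ hl
        have : (l : Fin 4) ≠ j := fun h => hl (Subtype.ext h)
        simp [pderiv_X, j.2.symm, this]
      · simp
    rw [hF, map_add, Derivation.leibniz, hs, hs, pderiv_X_of_ne j.2.symm]
    simp [eval_coneMap]
  have hi : eval x (pderiv i F) = eval (proj i c x) g - ∑ j : {j : Fin 4 // j ≠ i}, c j *
      (x i * eval (proj i c x) (pderiv j g) + eval (proj i c x) (pderiv j f)) := by
    have hs : ∀ p : MvPolynomial {j : Fin 4 // j ≠ i} K, eval x (pderiv i (coneMap i c p)) =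
        - ∑ j : {j : Fin 4 // j ≠ i}, c j * eval (proj i c x) (pderiv j p) := by
      intro p
      rw [pderiv_coneMap, map_sum, ← Finset.sum_neg_distrib]
      refine Finset.sum_congr rfl fun j _ => ?_
      simp [pderiv_X, j.2, eval_coneMap, mul_comm]
    rw [hF, map_add, Derivation.leibniz, map_add, map_add, hs]
    simp only [smul_eq_mul, map_mul, hs, pderiv_X_self, eval_X, map_one, eval_coneMap, mul_add,
      Finset.sum_add_distrib, Finset.mul_sum, mul_neg]
    simp only [mul_left_comm (x i)]
    ring
  constructor
  · rintro ⟨h1, h2⟩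
    have h3 := fun j : {j : Fin 4 // j ≠ i} => (hne j).symm.trans (h2 j)
    have h4 := h2 i
    simp only [hi, h3, mul_zero, Finset.sum_const_zero, sub_zero] at h4
    rw [h0, h4, mul_zero, zero_add] at h1
    exact ⟨h1, h4, h3⟩
  · rintro ⟨h1, h2, h3⟩
    refine ⟨by rw [h0, h1, h2]; ring, fun k => ?_⟩
    by_cases hk : k = i
    · subst hk
      simp [hi, h2, h3]
    · rw [hne ⟨k, hk⟩, h3]

theorem infinite_singularLocus_of_line [Infinite K] {F : MvPolynomial (Fin 4) K} {d : ℕ}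
    (hd : F.IsHomogeneous d) {f g : MvPolynomial {j : Fin 4 // j ≠ i} K}
    (hF : F = X i * coneMap i c g + coneMap i c f) {u : {j : Fin 4 // j ≠ i} → K} (hu : u ≠ 0)
    (hf : eval u f = 0) (hg : eval u g = 0) (hfd : ∀ j, eval u (pderiv j f) = 0)
    (hgd : ∀ j, eval u (pderiv j g) = 0) : (singularLocus F).Infinite := by
  classical
  -- The point over `u` with `i`-th coordinate `s`; these run along a line through the centre.
  let y : K → Fin 4 → K := fun s j => if h : j = i then s else u ⟨j, h⟩ + c j * s
  have hyi : ∀ s, y s i = s := fun s => by simp [y]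
  have hy : ∀ s, proj i c (y s) = u := by
    intro s
    funext j
    simp only [proj, hyi]
    simp [y, j.2]
  have hy0 : ∀ s, y s ≠ 0 := by
    intro s h
    apply hu
    rw [← hy s, h]
    funext j
    simp [proj]
  refine Set.infinite_of_injective_forall_mem (f := fun s => Projectivization.mk K (y s) (hy0 s))
    (fun s s' h => ?_) fun s => ?_
  · obtain ⟨a, ha⟩ := (Projectivization.mk_eq_mk_iff' K _ _ _ _).mp h
    have h1 : a • u = u := by rw [← hy s', ← proj_smul, ha, hy, hy]
    obtain ⟨j, hj⟩ := Function.ne_iff.mp hu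
    have h2 : a = 1 := by
      have := congrFun h1 j
      exact mul_right_cancel₀ hj (by simpa using this)
    have h3 := congrFun ha i
    simpa [h2, hyi] using h3.symm
  · rw [mk_mem_singularLocus hd, singular_iff_of_eq_add hF, hy]
    exact ⟨hf, hg, fun j => by rw [hfd, hgd]; ring⟩

theorem infinite_singularLocus_of_not_isRelPrime [IsAlgClosed K] {F : MvPolynomial (Fin 4) K}
    {d : ℕ} (hd : F.IsHomogeneous (d + 1)) (hF0 : F ≠ 0)
    {f g : MvPolynomial {j : Fin 4 // j ≠ i} K} (hF : F = X i * coneMap i c g + coneMap i c f)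
    (hg : g.IsHomogeneous d) (hg0 : g ≠ 0) (hrel : ¬ IsRelPrime f g) :
    (singularLocus F).Infinite := by
  obtain ⟨h, ⟨f', rfl⟩, ⟨g', rfl⟩, hu⟩ : ∃ h, h ∣ f ∧ h ∣ g ∧ ¬ IsUnit h := by
    unfold IsRelPrime at hrel
    push Not at hrel
    exact hrel
  have hh0 : h ≠ 0 := left_ne_zero_of_mul hg0
  have hh := isHomogeneous_of_mul hg hg0
  -- Since `h` divides `g`, its degree is less than that of `F`, so the cofactor `B` has positive
  -- degree.
  have hle : h.totalDegree ≤ d := by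
    have := totalDegree_mul_of_isDomain hh0 (right_ne_zero_of_mul hg0)
    rw [hg.totalDegree hg0] at this
    omega
  have he : h.totalDegree ≠ 0 := by
    intro he
    rw [totalDegree_eq_zero_iff_eq_C] at he
    apply hu
    rw [he]
    refine (IsUnit.mk0 _ fun h0 => hh0 ?_).map C
    rw [he, h0, C_0]
  have hA := isHomogeneous_coneMap i c hh
  let B := X i * coneMap i c g' + coneMap i c f'
  have hFB : F = B * coneMap i c h := by
    rw [hF, map_mul, map_mul]
    simp only [B]
    ring
  have hB := isHomogeneous_of_mul (hFB ▸ hd) (hFB ▸ hF0)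
  have hdeg := (hB.mul hA).inj_right (hFB ▸ hd) (hFB ▸ hF0)
  refine (infinite_setOf_eval_rep_eq_zero (by simp) hA hB he (by omega)).mono ?_
  rintro p ⟨h1, h2⟩
  refine ⟨by rw [hFB, map_mul, h1, mul_zero], fun k => ?_⟩
  rw [hFB, Derivation.leibniz, map_add, smul_eq_mul, smul_eq_mul, map_mul, map_mul, h1, h2]
  ring

end projection

/-! ### The equation of a monoid surface -/

section monoid

variable {K : Type*} [Field K]

theorem totalDegree_localEquation_le (F : MvPolynomial (Fin 4) K) (v : Fin 4 → K) (i : Fin 4) :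
    (localEquation F v i).totalDegree ≤ F.totalDegree := by
  rw [localEquation, aeval_def, eval₂_eq]
  refine totalDegree_finsetSum_le fun e he => ?_
  refine (totalDegree_mul _ _).trans ?_
  rw [algebraMap_eq, totalDegree_C, zero_add]
  refine (totalDegree_finsetProd _ _).trans ((Finset.sum_le_sum fun j _ => ?_).trans
    (le_totalDegree he))
  refine (totalDegree_pow _ _).trans (mul_le_of_le_one_right (Nat.zero_le _) ?_)
  split_ifs
  · simp
  · exact (totalDegree_add _ _).trans (by simp)

theorem eval_localEquation (F : MvPolynomial (Fin 4) K) (v : Fin 4 → K) (i : Fin 4)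
    {x : Fin 4 → K} (hx : x i = 1) :
    eval (proj i (fun j => v j / v i) x) (localEquation F v i) = eval x F := by
  rw [localEquation, ← aeval_eq_eval, ← aeval_eq_eval]
  change aeval _ (aeval _ F) = aeval _ F
  rw [← AlgHom.comp_apply, comp_aeval]
  congr 2
  funext j
  by_cases h : j = i
  · simp [h, hx]
  · simp [h, proj, hx]

/-- A form of degree `d + 1` with a point of multiplicity `d` is linear in a coordinate. -/
theorem exists_eq_add_of_order_localEquation [Infinite K] {F : MvPolynomial (Fin 4) K} {d : ℕ}
    (hF : F.IsHomogeneous (d + 1)) (v : Fin 4 → K) (i : Fin 4)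
    (hord : (localEquation F v i : MvPowerSeries {j : Fin 4 // j ≠ i} K).order = d) :
    ∃ f g : MvPolynomial {j : Fin 4 // j ≠ i} K, f.IsHomogeneous (d + 1) ∧ g.IsHomogeneous d ∧
      g ≠ 0 ∧ F = X i * coneMap i (fun j => v j / v i) g + coneMap i (fun j => v j / v i) f := by
  obtain ⟨⟨e, he, hed⟩, hlow⟩ := MvPowerSeries.order_eq_nat.mp hord
  simp only [MvPolynomial.coeff_coe] at he hlow
  set L := localEquation F v i with hL
  have hf := homogeneousComponent_isHomogeneous (d + 1) L
  have hg := homogeneousComponent_isHomogeneous d L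
  -- The order bounds degrees below by `d` and the total degree bounds them above by `d + 1`, so
  -- only two components survive.
  have hsum : L = homogeneousComponent d L + homogeneousComponent (d + 1) L := by
    ext s
    rw [coeff_add, coeff_homogeneousComponent, coeff_homogeneousComponent]
    rcases lt_trichotomy s.degree d with h | h | h
    · rw [if_neg (by omega), if_neg (by omega), hlow s h, add_zero]
    · rw [if_pos h, if_neg (by omega), add_zero]
    · by_cases h' : s.degree = d + 1
      · rw [if_neg (by omega), if_pos h', zero_add]
      · rw [if_neg (by omega), if_neg h', add_zero]
        refine coeff_eq_zero_of_totalDegree_lt ?_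
        have h1 : L.totalDegree ≤ d + 1 := (totalDegree_localEquation_le F v i).trans hF.totalDegree_le
        have h2 : s.degree = ∑ j ∈ s.support, s j := rfl
        omega
  refine ⟨_, _, hf, hg, fun h0 => he ?_, ?_⟩
  · have := congrArg (coeff e) h0
    rwa [coeff_homogeneousComponent, if_pos hed, coeff_zero] at this
  -- Multiplying by `X i` reduces the identity to points with `x i ≠ 0`, which rescale into the
  -- chart `x i = 1`.
  · refine mul_left_cancel₀ (X_ne_zero (R := K) i) (MvPolynomial.funext fun x => ?_)
    rw [map_mul, map_mul]
    by_cases hx : x i = 0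
    · simp [hx]
    congr 1
    have hx' : x = x i • ((x i)⁻¹ • x) := by rw [smul_smul, mul_inv_cancel₀ hx, one_smul]
    have h1 : ((x i)⁻¹ • x) i = 1 := by simp [hx]
    rw [map_add, map_mul, eval_X, eval_coneMap, eval_coneMap]
    generalize (x i)⁻¹ • x = y at hx' h1
    rw [hx', proj_smul, eval_smul_of_isHomogeneous hF, eval_smul_of_isHomogeneous hf,
      eval_smul_of_isHomogeneous hg, ← eval_localEquation F v i h1, ← hL]
    conv_lhs => rw [hsum]
    simp only [Pi.smul_apply, h1, map_add, smul_eq_mul]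
    ring

/-- The kernel of `φ` has dimension at least 2, so it is not contained in the line spanned by `v`.
-/
theorem exists_linearIndependent_apply_eq_zero {σ : Type*} [Fintype σ]
    (hσ : Fintype.card σ = 3) {v : σ → K} (hv : v ≠ 0) (φ : Module.Dual K (σ → K)) :
    ∃ w, LinearIndependent K ![v, w] ∧ φ w = 0 := by
  by_contra! hcon
  have hle : LinearMap.ker φ ≤ K ∙ v := by
    intro w hw
    by_contra hwv
    refine hcon w ((LinearIndependent.pair_iff' hv).mpr fun a ha => hwv ?_) hw
    exact Submodule.mem_span_singleton.mpr ⟨a, ha⟩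
  have h1 := Submodule.finrank_mono hle
  have h2 := φ.finrank_range_add_finrank_ker
  have h3 := (LinearMap.range φ).finrank_le
  rw [finrank_span_singleton hv] at h1
  simp only [Module.finrank_fintype_fun_eq_card, Module.finrank_self, hσ] at h2 h3
  omega

/-- The directional derivative at `v` as a linear form in the direction. -/
def gradient {σ : Type*} [Fintype σ] (v : σ → K) (p : MvPolynomial σ K) : Module.Dual K (σ → K) :=
  Fintype.linearCombination K fun j => eval v (pderiv j p)

theorem gradient_apply {σ : Type*} [Fintype σ] (v w : σ → K) (p : MvPolynomial σ K) :
    gradient v p w = dirDeriv v w p := by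
  simp [gradient, Fintype.linearCombination_apply, dirDeriv_apply]

theorem mk_smul_eq {V : Type*} [AddCommGroup V] [Module K V] (q : ℙ K V) (a : K)
    (h : a • q.rep ≠ 0) : Projectivization.mk K (a • q.rep) h = q := by
  conv_rhs => rw [← q.mk_rep]
  exact (Projectivization.mk_eq_mk_iff' K _ _ _ _).mpr ⟨a, rfl⟩

theorem ncard_singularLocus_le [IsAlgClosed K] {F : MvPolynomial (Fin 4) K} {d : ℕ} (hF0 : F ≠ 0)
    (hF : F.IsHomogeneous (d + 1)) (hfin : (singularLocus F).Finite) {p : ℙ K (Fin 4 → K)}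
    (hp : HasMultiplicity F p d) :
    (singularLocus F).ncard ≤ 1 + (d + 1) * d / 2 := by
  classical
  have : Infinite K := IsAlgClosed.instInfinite
  obtain ⟨i, hi, hord⟩ := hp
  obtain ⟨f, g, hf, hg, hg0, hFfg⟩ := exists_eq_add_of_order_localEquation hF p.rep i hord
  set c : Fin 4 → K := fun j => p.rep j / p.rep i with hc
  have hrel : IsRelPrime f g := by
    by_contra hrel
    exact infinite_singularLocus_of_not_isRelPrime hF hF0 hFfg hg hg0 hrel hfin
  let T := singularLocus F \ {p}
  have hT : T.Finite := hfin.subset Set.sdiff_subset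
  have : Fintype T := hT.fintype
  -- The scalar `a` lets two points with proportional projections be compared over the same vector.
  have hrep : ∀ q : T, ∀ a : K, a ≠ 0 →
      eval (a • proj i c q.1.rep) f = 0 ∧ eval (a • proj i c q.1.rep) g = 0 ∧
        ∀ j, (a * q.1.rep i) * eval (a • proj i c q.1.rep) (pderiv j g) +
          eval (a • proj i c q.1.rep) (pderiv j f) = 0 := by
    intro q a ha
    have hne : a • q.1.rep ≠ 0 := smul_ne_zero ha q.1.rep_nonzero
    have hmem : Projectivization.mk K (a • q.1.rep) hne ∈ singularLocus F := by
      rw [mk_smul_eq]; exact q.2.1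
    rw [mk_mem_singularLocus hF, singular_iff_of_eq_add hFfg, proj_smul] at hmem
    exact hmem
  have hV0 : ∀ q : T, proj i c q.1.rep ≠ 0 := by
    intro q h0
    refine q.2.2 ?_
    have h1 : (q.1.rep i / p.rep i) • p.rep = q.1.rep := by
      funext j
      by_cases hj : j = i
      · rw [hj]; simp [hi]
      · have := congrFun h0 ⟨j, hj⟩
        simp only [proj, hc, Pi.zero_apply, sub_eq_zero] at this
        rw [this, Pi.smul_apply, smul_eq_mul]
        ring
    rw [Set.mem_singleton_iff, ← q.1.mk_rep, ← p.mk_rep]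
    exact (Projectivization.mk_eq_mk_iff' K _ _ _ _).mpr ⟨_, h1⟩
  have hcard : Fintype.card {j : Fin 4 // j ≠ i} = 3 := by simp
  -- A direction killing `∇g` also kills `∇f = -x_i ∇g`.
  choose w hw hgw using fun q : T =>
    exists_linearIndependent_apply_eq_zero hcard (hV0 q) (gradient (proj i c q.1.rep) g)
  have hgw' : ∀ q : T, dirDeriv (proj i c q.1.rep) (w q) g = 0 := fun q => by
    rw [← gradient_apply, hgw]
  have hrep1 := fun q : T => hrep q 1 one_ne_zero
  simp only [one_smul, one_mul] at hrep1
  have hfw : ∀ q : T, dirDeriv (proj i c q.1.rep) (w q) f = 0 := by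
    intro q
    have h1 := (hrep1 q).2.2
    have h2 : dirDeriv (proj i c q.1.rep) (w q) f
        = - (q.1.rep i * dirDeriv (proj i c q.1.rep) (w q) g) := by
      rw [dirDeriv_apply, dirDeriv_apply, Finset.mul_sum, ← Finset.sum_neg_distrib]
      refine Finset.sum_congr rfl fun j _ => ?_
      linear_combination (w q j) * h1 j
    rw [h2, hgw', mul_zero, neg_zero]
  have hpair : Pairwise fun q r : T =>
      LinearIndependent K ![proj i c q.1.rep, proj i c r.1.rep] := by
    intro q r hqr
    refine (LinearIndependent.pair_iff' (hV0 q)).mpr fun a ha => hqr (Subtype.ext ?_)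
    have ha0 : a ≠ 0 := by
      rintro rfl
      exact hV0 r (by rw [← ha, zero_smul])
    have h1 := hrep q a ha0
    rw [ha] at h1
    have h2 := hrep1 r
    by_cases heq : a * q.1.rep i = r.1.rep i
    · have h3 : a • q.1.rep = r.1.rep :=
        eq_of_proj_eq (i := i) (c := c) (by rw [proj_smul, ha]) heq
      rw [← q.1.mk_rep, ← r.1.mk_rep]
      exact ((Projectivization.mk_eq_mk_iff' K _ _ _ _).mpr ⟨a, h3⟩).symm
    -- Different `i`-th coordinates over one vector: subtracting the two gradient relations gives
    -- `∇g = 0`, then `∇f = 0`.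
    · have hgd : ∀ j, eval (proj i c r.1.rep) (pderiv j g) = 0 := by
        intro j
        refine (mul_eq_zero.mp ?_).resolve_left (sub_ne_zero.mpr heq)
        linear_combination h1.2.2 j - h2.2.2 j
      have hfd : ∀ j, eval (proj i c r.1.rep) (pderiv j f) = 0 := fun j => by
        simpa [hgd] using h2.2.2 j
      exact absurd hfin
        (infinite_singularLocus_of_line hF hFfg (hV0 r) h2.1 h2.2.1 hfd hgd)
  have hmain := two_mul_card_le_of_isRelPrime hcard hf hg hg0 hrel hw hpair
    (fun q => (hrep1 q).1) (fun q => (hrep1 q).2.1) hfw hgw'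
  -- The extra 1 accounts for `p`, whether or not it is singular.
  have h1 : (singularLocus F).ncard ≤ T.ncard + 1 := by
    have := Set.ncard_le_ncard_sdiff_add_ncard (singularLocus F) {p}
    rwa [Set.ncard_singleton] at this
  rw [Set.ncard_eq_toFinset_card' T, Set.toFinset_card] at h1
  omega

end monoid

end ProjSurface

end

theorem mainTheorem5 {K : Type*} [Field K] [IsAlgClosed K] :
    (∀ F : MvPolynomial (Fin 4) K, F ≠ 0 → F.IsHomogeneous 4 →
      (ProjSurface.singularLocus F).Finite →
      (∃ p : ℙ K (Fin 4 → K), ProjSurface.HasMultiplicity F p 3) →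
      (ProjSurface.singularLocus F).ncard ≤ 7) ∧
    (∀ (d : ℕ) (F : MvPolynomial (Fin 4) K), 1 ≤ d → F ≠ 0 → F.IsHomogeneous d →
      (ProjSurface.singularLocus F).Finite →
      (∃ p : ℙ K (Fin 4 → K), ProjSurface.HasMultiplicity F p (d - 1)) →
      (ProjSurface.singularLocus F).ncard ≤ 1 + d * (d - 1) / 2) := by
  refine ⟨fun F hF0 hF hfin ⟨p, hp⟩ => ?_, fun d F hd hF0 hF hfin ⟨p, hp⟩ => ?_⟩
  -- Here `d = 3`, and `1 + 4 * 3 / 2` evaluates to 7.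
  · exact ProjSurface.ncard_singularLocus_le hF0 hF hfin hp
  · obtain ⟨e, rfl⟩ := Nat.exists_eq_add_of_le' hd
    exact ProjSurface.ncard_singularLocus_le hF0 hF hfin hp
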